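/- Let $q$ be a prime, let $\mathbb F_q$ be the field with $q$ elements, and let $M_n(\mathbb F_q)$ be the ring of $n\times n$ matrices over $\mathbb F_q$. Let $M_n(\mathbb F_q)[x]$ be the ring of polynomials with coefficients in $M_n(\mathbb F_q)$ in an indeterminate $x$ that commutes with all coefficients; for $f=\sum_i c_i x^i\in M_n(\mathbb F_q)[x]$ and $A\in M_n(\mathbb F_q)$ put $f(A)=\sum_i c_i A^i$ (coefficients on the left). For $S\subseteq M_n(\mathbb F_q)$ let $$N(S)=\{f\in M_n(\mathbb F_q)[x] : f(A)=0 \text{ for all } A\in S\},$$ and call $S$ a core set if $N(S)$ is a two-sided ideal of $M_n(\mathbb F_q)[x]$, and a non-core set otherwise (so the empty set is a core set). Theorem 6.4 (Theorem 1.8 in the introduction). Let $\mathcal C=\{PAP^{-1} : P\in \mathrm{GL}(n,\mathbb F_q)\}$ be the similarity class of some matrix $A\in M_n(\mathbb F_q)$, and let $S\subseteq\mathcal C$ be a non-core set. Then $$|S|\le \frac{4|\mathcal C|}{q}.$$ -/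

import Mathlib

open Polynomial

/-- The zero ideal `N(S)` of a set `S` of `n × n` matrices over `F`: all polynomials with matrix
coefficients, with central indeterminate, that vanish at every matrix of `S`. Evaluation is right
evaluation: `(∑ i, cᵢ xⁱ)(A) = ∑ i, cᵢ * Aⁱ`, which is what `Polynomial.eval` is over a
noncommutative ring. -/
def zeroIdeal {n : ℕ} {F : Type*} [Field F] (S : Set (Matrix (Fin n) (Fin n) F)) :
    Set (Matrix (Fin n) (Fin n) F)[X] :=
  {f | ∀ A ∈ S, f.eval A = 0}

/-- `S` is a core set if its zero ideal is a two-sided ideal of `M_n(F)[x]`. -/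
def IsCoreSet {n : ℕ} {F : Type*} [Field F] (S : Set (Matrix (Fin n) (Fin n) F)) : Prop :=
  ∃ I : TwoSidedIdeal (Matrix (Fin n) (Fin n) F)[X],
    (I : Set (Matrix (Fin n) (Fin n) F)[X]) = zeroIdeal S

/-- `C` is a similarity class in `M_n(F)`: for some matrix `A`, it consists of all `P A P⁻¹` with
`P` an invertible matrix over `F`. -/
def IsSimilarityClass {n : ℕ} {F : Type*} [Field F] (C : Set (Matrix (Fin n) (Fin n) F)) : Prop :=
  ∃ A : Matrix (Fin n) (Fin n) F,
    C = {B | ∃ P : GL (Fin n) F,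
      B = (P : Matrix (Fin n) (Fin n) F) * A * (P⁻¹ : GL (Fin n) F)}

/-! `N(S)` is always a left ideal stable under right multiplication by `x`, so a non-core `S` yields
`f ∈ N(S)`, a constant `B` and `A ∈ S` with `(f B)(A) ≠ 0`. The linear map `M ↦ (f M)(A)` is then
nonzero, and its kernel has at most `q ^ (n² - 1)` elements. By `eval_conj_mul`, that kernel
contains every invertible `P` with `P A P⁻¹ ∈ S`; there are `|S| k` of these, where `k` is the order
of the centralizer of `A` in `GL`. Since `|C| k = |GL| ≥ q ^ (n²) / 4`, dividing gives the bound. -/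

/-- The zero ideal is closed under left multiplication. -/
lemma mul_mem_zeroIdeal_left {n : ℕ} {F : Type*} [Field F]
    {S : Set (Matrix (Fin n) (Fin n) F)} (g : (Matrix (Fin n) (Fin n) F)[X])
    {f : (Matrix (Fin n) (Fin n) F)[X]} (hf : f ∈ zeroIdeal S) : g * f ∈ zeroIdeal S := by
  intro A hA
  induction g using Polynomial.induction_on' with
  | add p r hp hr => rw [add_mul, eval_add, hp, hr, add_zero]
  | monomial k a =>
    rw [← C_mul_X_pow_eq_monomial, mul_assoc, X_pow_mul, eval_C_mul, eval_mul_X_pow, hf A hA,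
      zero_mul, mul_zero]

/-- If the zero ideal is closed under right multiplication by constants, then it is two-sided. -/
lemma isCoreSet_of_mul_C_mem {n : ℕ} {F : Type*} [Field F]
    {S : Set (Matrix (Fin n) (Fin n) F)}
    (h : ∀ f ∈ zeroIdeal S, ∀ B : Matrix (Fin n) (Fin n) F, f * C B ∈ zeroIdeal S) :
    IsCoreSet S := by
  refine ⟨TwoSidedIdeal.mk' (zeroIdeal S) ?_ ?_ ?_ ?_ ?_, ?_⟩
  · exact fun A _ => eval_zero
  · intro f g hf hg A hA
    rw [eval_add, hf A hA, hg A hA, add_zero]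
  · intro f hf A hA
    rw [eval_neg, hf A hA, neg_zero]
  · exact fun {g f} hf => mul_mem_zeroIdeal_left g hf
  · intro f g hf A hA
    induction g using Polynomial.induction_on' with
    | add p r hp hr => rw [mul_add, eval_add, hp, hr, add_zero]
    | monomial k a =>
      rw [← C_mul_X_pow_eq_monomial, ← mul_assoc, eval_mul_X_pow, h f hf a A hA, zero_mul]
  · exact TwoSidedIdeal.coe_mk' _ _ _ _ _ _

/-- Evaluating `f` at a conjugate of `A` amounts to evaluating `f * C P` at `A`. -/
lemma eval_conj_mul {R : Type*} [Ring R] (f : R[X]) (A : R) (P : Rˣ) :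
    f.eval (P * A * (P⁻¹ : Rˣ)) * P = (f * C (P : R)).eval A := by
  induction f using Polynomial.induction_on' with
  | add p r hp hr => rw [eval_add, add_mul, add_mul, eval_add, hp, hr]
  | monomial k a =>
    rw [eval_monomial, monomial_mul_C, eval_monomial, Units.conj_pow]
    simp [mul_assoc]

/-- The matrices `B` with `(f * C B)(A) = 0` make up at most a fraction `1 / q` of all matrices,
if there is a matrix that is not among them. -/
lemma mul_card_eval_mul_C_eq_zero_le {q n : ℕ} [Fact q.Prime]
    (f : (Matrix (Fin n) (Fin n) (ZMod q))[X]) (A B : Matrix (Fin n) (Fin n) (ZMod q))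
    (hB : (f * C B).eval A ≠ 0) :
    q * Nat.card {M : Matrix (Fin n) (Fin n) (ZMod q) // (f * C M).eval A = 0} ≤ q ^ (n * n) := by
  have hsmul : ∀ (t : ZMod q) (M : Matrix (Fin n) (Fin n) (ZMod q)),
      (f * C (t • M)).eval A = t • (f * C M).eval A := by
    intro t M
    rw [← smul_C, mul_smul_comm, eval_smul]
  -- The `q` translates of the kernel by multiples of `B` are pairwise disjoint.
  have hinj : Function.Injective
      (fun p : ZMod q × {M : Matrix (Fin n) (Fin n) (ZMod q) // (f * C M).eval A = 0} =>
        p.1 • B + p.2.1) := by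
    rintro ⟨s, M, hM⟩ ⟨t, N, hN⟩ h
    simp only at h
    have h' := congrArg (fun M => (f * C M).eval A) h
    simp only [C_add, mul_add, eval_add, hM, hN, add_zero, hsmul] at h'
    obtain rfl := smul_left_injective _ hB h'
    obtain rfl := add_left_cancel h
    rfl
  have hle := Nat.card_le_card_of_injective _ hinj
  rw [Nat.card_prod, Nat.card_zmod] at hle
  refine hle.trans_eq ?_
  simp [Nat.card_eq_fintype_card, Matrix, ZMod.card, pow_mul]

/-- The proportion of invertible matrices is at least `1 / 4 + 1 / (2 q ^ n)`. -/
lemma prod_pow_sub_pow_lower_bound {q : ℝ} (hq : 2 ≤ q) (n : ℕ) :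
    q ^ ((n + 1) * (n + 1)) * (1 / 4 + 1 / (2 * q ^ (n + 1))) ≤
      ∏ i : Fin (n + 1), (q ^ (n + 1) - q ^ (i : ℕ)) := by
  have hq0 : 0 < q := by linarith
  -- The bound `1 / 4` alone would not survive the induction, since each step brings in a factor
  -- below 1; the extra term absorbs that loss.
  induction n with
  | zero =>
    rw [Fin.prod_univ_succ, Fin.prod_univ_zero, Fin.val_zero, pow_zero, mul_one]
    simp only [zero_add, mul_one, pow_one]
    field_simp
    linarith
  | succ n ih =>
    have hprod : ∏ i : Fin (n + 1 + 1), (q ^ (n + 1 + 1) - q ^ (i : ℕ)) =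
        (q ^ (n + 2) - 1) * (q ^ (n + 1) * ∏ i : Fin (n + 1), (q ^ (n + 1) - q ^ (i : ℕ))) := by
      rw [Fin.prod_univ_succ, Fin.val_zero, pow_zero]
      congr 1
      have : ∀ i : Fin (n + 1), q ^ (n + 1 + 1) - q ^ (i.succ : ℕ) =
          q * (q ^ (n + 1) - q ^ (i : ℕ)) := fun i => by rw [Fin.val_succ]; ring
      simp_rw [this, Finset.prod_mul_distrib, Finset.prod_const, Finset.card_univ, Fintype.card_fin]
    have hle : q ^ (n + 1) ≥ 2 := hq.trans (le_self_pow₀ (by linarith) (by omega))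
    have hone : 0 ≤ q ^ (n + 2) - 1 := sub_nonneg.2 (one_le_pow₀ (by linarith))
    rw [hprod]
    refine le_trans ?_ (mul_le_mul_of_nonneg_left (mul_le_mul_of_nonneg_left ih
      (by positivity)) hone)
    have e1 : q ^ ((n + 1 + 1) * (n + 1 + 1)) =
        q ^ ((n + 1) * (n + 1)) * q ^ (n + 1) * (q ^ (n + 1) * q) := by ring
    have e2 : q ^ (n + 2) = q ^ (n + 1) * q := by ring
    rw [e1, e2]
    set y := q ^ (n + 1)
    set z := q ^ ((n + 1) * (n + 1))
    have hz : 0 < z := by positivity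
    have hy : 0 < y := by positivity
    -- This reduces to `1 / 2 + 1 / 4 + 1 / (2 y) ≤ q / 2`, with equality at `q = y = 2`.
    have key : y * q * (1 / 4 + 1 / (2 * (y * q))) ≤ (y * q - 1) * (1 / 4 + 1 / (2 * y)) := by
      field_simp
      nlinarith [mul_nonneg (sub_nonneg.2 hle) (sub_nonneg.2 hq)]
    calc _ = z * y * (y * q * (1 / 4 + 1 / (2 * (y * q)))) := by ring
      _ ≤ z * y * ((y * q - 1) * (1 / 4 + 1 / (2 * y))) := by gcongr
      _ = _ := by ring

/-- At least a quarter of all matrices over a finite prime field are invertible. -/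
lemma pow_le_four_mul_card_GL (q n : ℕ) [Fact q.Prime] :
    (q : ℝ) ^ (n * n) ≤ 4 * (Nat.card (GL (Fin n) (ZMod q)) : ℝ) := by
  have hq : 2 ≤ q := (Fact.out : q.Prime).two_le
  rw [Matrix.card_GL_field, ZMod.card, Nat.cast_prod]
  rcases n with _ | n
  · norm_num
  have hcast : ∀ i : Fin (n + 1), ((q ^ (n + 1) - q ^ (i : ℕ) : ℕ) : ℝ) =
      (q : ℝ) ^ (n + 1) - (q : ℝ) ^ (i : ℕ) := fun i => by
    rw [Nat.cast_sub (Nat.pow_le_pow_right (by omega) i.2.le)]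
    push_cast
    rfl
  simp_rw [hcast]
  have h := prod_pow_sub_pow_lower_bound (q := q) (by exact_mod_cast hq) n
  have h' : (q : ℝ) ^ ((n + 1) * (n + 1)) * (1 / 4) ≤
      (q : ℝ) ^ ((n + 1) * (n + 1)) * (1 / 4 + 1 / (2 * (q : ℝ) ^ (n + 1))) := by
    gcongr
    exact le_add_of_nonneg_right (by positivity)
  linarith

/-- Every subset `T` of the conjugation orbit of `a` has `|T|` times the order of the centralizer
of `a` many conjugating units. -/
lemma card_conj_mem_eq {R : Type*} [Ring R] [Finite R] (a : R) (T : Set R)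
    (hT : ∀ b ∈ T, ∃ P : Rˣ, b = P * a * (P⁻¹ : Rˣ)) :
    Nat.card {P : Rˣ // (P : R) * a * (P⁻¹ : Rˣ) ∈ T} =
      T.ncard * Nat.card {P : Rˣ // (P : R) * a * (P⁻¹ : Rˣ) = a} := by
  rw [← Nat.card_coe_set_eq, ← Nat.card_prod]
  choose g hg using hT
  have hconj : ∀ (P Q : Rˣ), ((P * Q : Rˣ) : R) * a * ((P * Q)⁻¹ : Rˣ) =
      P * (Q * a * (Q⁻¹ : Rˣ)) * (P⁻¹ : Rˣ) := fun P Q => by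
    simp only [Units.val_mul, mul_inv_rev, mul_assoc]
  have hval : ∀ (b : R) (hb : b ∈ T) (Q : Rˣ), (Q : R) * a * (Q⁻¹ : Rˣ) = a →
      ((g b hb * Q : Rˣ) : R) * a * ((g b hb * Q)⁻¹ : Rˣ) = b := fun b hb Q hQ => by
    rw [hconj, hQ, ← hg b hb]
  -- The units carrying `a` to `b` form the coset `g b` times the centralizer.
  refine (Nat.card_congr (Equiv.ofBijective
    (fun p : T × {P : Rˣ // (P : R) * a * (P⁻¹ : Rˣ) = a} =>
      (⟨g p.1 p.1.2 * p.2.1, by rw [hval _ _ _ p.2.2]; exact p.1.2⟩ :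
        {P : Rˣ // (P : R) * a * (P⁻¹ : Rˣ) ∈ T})) ⟨?_, ?_⟩)).symm
  · rintro ⟨⟨b, hb⟩, Q, hQ⟩ ⟨⟨c, hc⟩, Q', hQ'⟩ h
    have h := Subtype.ext_iff.1 h
    simp only at h
    obtain rfl : b = c := by rw [← hval b hb Q hQ, ← hval c hc Q' hQ', h]
    obtain rfl := mul_left_cancel h
    rfl
  · rintro ⟨P, hP⟩
    refine ⟨⟨⟨_, hP⟩, ⟨(g _ hP)⁻¹ * P, ?_⟩⟩, Subtype.ext (mul_inv_cancel_left _ _)⟩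
    rw [hconj]
    nth_rewrite 2 [hg _ hP]
    simp only [mul_assoc, inv_inv, Units.inv_mul_cancel_left, Units.inv_mul, mul_one]

theorem theorem6p4 (q n : ℕ) [Fact q.Prime] (C S : Set (Matrix (Fin n) (Fin n) (ZMod q)))
    (hC : IsSimilarityClass C) (hSC : S ⊆ C) (hS : ¬ IsCoreSet S) :
    (S.ncard : ℝ) ≤ 4 * (C.ncard : ℝ) / (q : ℝ) := by
  have hq : 0 < (q : ℝ) := by exact_mod_cast (Fact.out : q.Prime).pos
  obtain ⟨f, hf, B, hfB⟩ : ∃ f ∈ zeroIdeal S, ∃ B : Matrix (Fin n) (Fin n) (ZMod q),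
      f * Polynomial.C B ∉ zeroIdeal S := by
    by_contra! h
    exact hS (isCoreSet_of_mul_C_mem h)
  obtain ⟨A, hA, hAB⟩ : ∃ A ∈ S, (f * Polynomial.C B).eval A ≠ 0 := by
    by_contra! h
    exact hfB h
  -- The class is rebased at `A`, where `f B` does not vanish.
  have horb : ∀ D : Matrix (Fin n) (Fin n) (ZMod q), D ∈ C ↔ ∃ P : GL (Fin n) (ZMod q),
      D = (P : Matrix (Fin n) (Fin n) (ZMod q)) * A * (P⁻¹ : GL (Fin n) (ZMod q)) := by
    obtain ⟨A₀, rfl⟩ := hC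
    obtain ⟨P₀, hP₀⟩ := hSC hA
    intro D
    constructor
    · rintro ⟨P, rfl⟩
      refine ⟨P * P₀⁻¹, ?_⟩
      rw [hP₀]
      simp only [Units.val_mul, mul_inv_rev, inv_inv, mul_assoc, Units.inv_mul_cancel_left]
    · rintro ⟨P, rfl⟩
      refine ⟨P * P₀, ?_⟩
      rw [hP₀]
      simp only [Units.val_mul, mul_inv_rev, mul_assoc]
  set k := Nat.card {P : GL (Fin n) (ZMod q) //
    (P : Matrix (Fin n) (Fin n) (ZMod q)) * A * (P⁻¹ : GL (Fin n) (ZMod q)) = A}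
  have hkpos : 0 < k := by
    have : Nonempty {P : GL (Fin n) (ZMod q) //
      (P : Matrix (Fin n) (Fin n) (ZMod q)) * A * (P⁻¹ : GL (Fin n) (ZMod q)) = A} :=
      ⟨⟨1, by simp⟩⟩
    exact Nat.card_pos
  have hSk := card_conj_mem_eq A S fun b hb => (horb b).1 (hSC hb)
  have hCk := card_conj_mem_eq A C fun b hb => (horb b).1 hb
  have hall : Nat.card {P : GL (Fin n) (ZMod q) //
      (P : Matrix (Fin n) (Fin n) (ZMod q)) * A * (P⁻¹ : GL (Fin n) (ZMod q)) ∈ C} =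
      Nat.card (GL (Fin n) (ZMod q)) :=
    Nat.card_congr (Equiv.subtypeUnivEquiv fun P => (horb _).2 ⟨P, rfl⟩)
  have hker : Nat.card {P : GL (Fin n) (ZMod q) //
      (P : Matrix (Fin n) (Fin n) (ZMod q)) * A * (P⁻¹ : GL (Fin n) (ZMod q)) ∈ S} ≤
      Nat.card {M : Matrix (Fin n) (Fin n) (ZMod q) // (f * Polynomial.C M).eval A = 0} := by
    refine Nat.card_le_card_of_injective
      (fun P => ⟨P.1, by rw [← eval_conj_mul, hf _ P.2, zero_mul]⟩) fun P Q h => ?_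
    exact Subtype.ext (Units.ext (Subtype.ext_iff.1 h))
  have hle := mul_card_eval_mul_C_eq_zero_le f A B hAB
  have hGL := pow_le_four_mul_card_GL q n
  have h1 : (q : ℝ) * (S.ncard * k) ≤ (q : ℝ) ^ (n * n) := by
    rw [hSk] at hker
    exact_mod_cast (Nat.mul_le_mul_left q hker).trans hle
  have h2 : (Nat.card (GL (Fin n) (ZMod q)) : ℝ) = C.ncard * k := by
    rw [← hall, hCk, Nat.cast_mul]
  rw [h2] at hGL
  rw [le_div_iff₀ hq]
  have hk' : (0 : ℝ) < k := by exact_mod_cast hkpos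
  refine le_of_mul_le_mul_right ?_ hk'
  linarith
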